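/- Let $\mathrm{Pol}(\mathbb C)$ be the semigroup of complex polynomials in one variable under composition. A multiplicative character is a map $\Phi:\mathrm{Pol}(\mathbb C)\to\mathbb C$ with $\Phi(P\circ Q)=\Phi(P)\Phi(Q)$ for all $P,Q$. A polynomial $P$ is called prime if $P=Q\circ R$ with polynomials $Q,R$ implies $\deg Q=1$ or $\deg R=1$ (so every polynomial of degree one is prime). A prime decomposition of $P$ is an expression $P=P_1\circ\cdots\circ P_n$, $n\ge 1$, in which every $P_i$ is prime of degree at least $2$. Let $\phi$ be a complex function defined on the prime polynomials and the constants, and consider the conditions (i) $\phi(c)=0$ for every constant $c$; (ii) $\phi(P_1)\phi(P_2)=\phi(P_3)\phi(P_4)$ whenever $P_1,P_2,P_3,P_4$ are prime polynomials with $P_1\circ P_2=P_3\circ P_4$. (1) If $\phi$ satisfies (i) and (ii), then it generates a multiplicative character: there is a multiplicative character $\Phi$ that vanishes on constants and satisfies $\Phi(P)=\phi(P_1)\cdots\phi(P_n)$ for every polynomial $P$ and every prime decomposition $P=P_1\circ\cdots\circ P_n$. If moreover $\phi(z)=1$ for the identity polynomial $z$, or $\phi$ vanishes on all prime polynomials,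 then there is exactly one multiplicative character $\Phi$ that agrees with $\phi$ on all constants and all prime polynomials (those of degree one included), and this $\Phi$ is given by the same product formula. (2) Conversely, every multiplicative character $\Phi$ other than the constant $1$ satisfies (i) and (ii); moreover $\Phi(z)=1$ or $\Phi$ is identically $0$, and $\Phi(P)=\Phi(P_1)\cdots\Phi(P_n)$ for every prime decomposition $P=P_1\circ\cdots\circ P_n$. (3) Every polynomial $P$ of degree at least $2$ has a prime decomposition, and all its prime decompositions have the same length $l(P)$. Put $l(P)=0$ if $\deg P=1$. Then the function $\chi$ with $\chi(P)=e^{l(P)}$ for nonconstant $P$ and $\chi(c)=0$ for constants $c$ is a multiplicative character, and it is not a function of the degree: there is no $g:\mathbb N\to\mathbb C$ with $\chi(P)=g(\deg P)$ for all nonconstant $P$. -/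

import Mathlib

open Polynomial

/-- A complex polynomial is prime (indecomposable) if in every decomposition `P = Q ∘ R` one of
the factors has degree one. Polynomials of degree one are prime, constants are not. -/
def IsPrimePoly (P : ℂ[X]) : Prop :=
  ∀ Q R : ℂ[X], P = Q.comp R → Q.natDegree = 1 ∨ R.natDegree = 1

/-- The composition `P₁ ∘ P₂ ∘ ⋯ ∘ Pₙ` of a list of polynomials. -/
noncomputable def compList (L : List ℂ[X]) : ℂ[X] :=
  L.foldr (fun P Q => P.comp Q) X

/-- `L = [P₁, …, Pₙ]`, `n ≥ 1`, is a prime decomposition of `P`: `P = P₁ ∘ ⋯ ∘ Pₙ` and each `Pᵢ`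
is a prime polynomial of degree at least two. -/
def IsPrimeDecomposition (P : ℂ[X]) (L : List ℂ[X]) : Prop :=
  L ≠ [] ∧ (∀ Q ∈ L, IsPrimePoly Q ∧ 2 ≤ Q.natDegree) ∧ compList L = P

/-- Multiplicative characters of the semigroup of complex polynomials under composition. -/
def IsMultiplicativeCharacter (Φ : ℂ[X] → ℂ) : Prop :=
  ∀ P Q : ℂ[X], Φ (P.comp Q) = Φ P * Φ Q

/-- The two conditions on a complex function of prime polynomials and constants. Only the values
of `φ` on prime polynomials and on constants matter. -/
def CharacterConditions (φ : ℂ[X] → ℂ) : Prop :=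
  (∀ c : ℂ, φ (C c) = 0) ∧
  (∀ P₁ P₂ P₃ P₄ : ℂ[X], IsPrimePoly P₁ → IsPrimePoly P₂ → IsPrimePoly P₃ → IsPrimePoly P₄ →
    P₁.comp P₂ = P₃.comp P₄ → φ P₁ * φ P₂ = φ P₃ * φ P₄)

/-- `Φ` is obtained from `φ` by taking products over prime decompositions (for any choice of the
decomposition), and it vanishes on constants. -/
def IsGeneratedBy (Φ φ : ℂ[X] → ℂ) : Prop :=
  (∀ c : ℂ, Φ (C c) = 0) ∧
  (∀ (P : ℂ[X]) (L : List ℂ[X]), IsPrimeDecomposition P L → Φ P = (L.map φ).prod)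

/-- `Φ` takes the same values as `φ` on all constants and on all prime polynomials, those of
degree one included. -/
def ExtendsOnPrimes (Φ φ : ℂ[X] → ℂ) : Prop :=
  (∀ c : ℂ, Φ (C c) = φ (C c)) ∧ (∀ P : ℂ[X], IsPrimePoly P → Φ P = φ P)

/-- The (least) length of a prime decomposition of `P`. Polynomials of degree one have no prime
decomposition, and their length is `sInf ∅ = 0`. -/
noncomputable def primeLength (P : ℂ[X]) : ℕ :=
  sInf {n : ℕ | ∃ L : List ℂ[X], IsPrimeDecomposition P L ∧ L.length = n}

/-- The function `P ↦ e ^ l(P)`, where `l(P)` is the length of a prime decomposition of the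
nonconstant polynomial `P`, extended by zero to the constants. -/
noncomputable def lengthCharacter (P : ℂ[X]) : ℂ :=
  if P.natDegree = 0 then 0 else Complex.exp (primeLength P : ℂ)

/-! ### Laurent series in a parameter at infinity -/

lemma algebraMap_hahnSeries_eq_C (r : ℂ) :
    algebraMap ℂ (HahnSeries ℤ ℂ) r = HahnSeries.C r := by
  simp [HahnSeries.algebraMap_apply']

lemma algebraMap_mul_coeff (r : ℂ) (x : HahnSeries ℤ ℂ) (k : ℤ) :
    (algebraMap ℂ (HahnSeries ℤ ℂ) r * x).coeff k = r * x.coeff k := by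
  rw [algebraMap_hahnSeries_eq_C, HahnSeries.C_apply, HahnSeries.coeff_single_zero_mul]

/-- The automorphism `t ↦ ω t` of the field of Laurent series in `t`. -/
noncomputable def twist (ω : ℂˣ) : HahnSeries ℤ ℂ →ₐ[ℂ] HahnSeries ℤ ℂ where
  toFun x :=
    { coeff := fun k => ((ω ^ k : ℂˣ) : ℂ) * x.coeff k
      isPWO_support' := x.isPWO_support.mono fun k hk => by
        simp only [Function.mem_support, ne_eq, mul_eq_zero, not_or] at hk
        exact hk.2 }
  map_one' := by
    ext k
    simp only [HahnSeries.coeff_one]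
    split_ifs with h <;> simp [h]
  map_zero' := by ext k; simp
  map_add' x y := by ext k; simp [mul_add]
  map_mul' x y := by
    ext k
    -- As `ω ^ k ≠ 0`, twisting keeps supports, so both convolution sums run over the same
    -- antidiagonal.
    have hs : ∀ x : HahnSeries ℤ ℂ, (⟨fun k => ((ω ^ k : ℂˣ) : ℂ) * x.coeff k,
        x.isPWO_support.mono fun k hk => by
          simp only [Function.mem_support, ne_eq, mul_eq_zero, not_or] at hk
          exact hk.2⟩ : HahnSeries ℤ ℂ).support = x.support := by
      intro x
      ext k
      simp [zpow_ne_zero]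
    rw [HahnSeries.coeff_mul]
    simp only [HahnSeries.coeff_mul, hs]
    rw [Finset.mul_sum]
    refine Finset.sum_congr rfl fun ij hij => ?_
    rw [Finset.mem_antidiagonal] at hij
    rw [← hij.2.2, zpow_add, Units.val_mul]
    ring
  commutes' r := by
    ext k
    rw [algebraMap_hahnSeries_eq_C, HahnSeries.C_apply, HahnSeries.coeff_single]
    split_ifs with h <;> simp [h]

lemma twist_coeff (ω : ℂˣ) (x : HahnSeries ℤ ℂ) (k : ℤ) :
    (twist ω x).coeff k = ((ω ^ k : ℂˣ) : ℂ) * x.coeff k := rfl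

lemma twist_twist (ω η : ℂˣ) (x : HahnSeries ℤ ℂ) : twist ω (twist η x) = twist (ω * η) x := by
  ext k
  simp [twist_coeff, mul_zpow, mul_assoc]

lemma twist_one (x : HahnSeries ℤ ℂ) : twist 1 x = x := by
  ext k
  simp [twist_coeff]

lemma twist_order (ω : ℂˣ) (x : HahnSeries ℤ ℂ) : (twist ω x).order = x.order := by
  by_cases hx : x = 0
  · simp [hx]
  have h0 : twist ω x ≠ 0 := by simpa using hx
  apply le_antisymm
  · apply HahnSeries.order_le_of_coeff_ne_zero
    rw [twist_coeff]
    exact mul_ne_zero (Units.ne_zero _) (HahnSeries.coeff_order_eq_zero.not.mpr hx)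
  · apply HahnSeries.order_le_of_coeff_ne_zero
    have := HahnSeries.coeff_order_eq_zero.not.mpr h0
    rw [twist_coeff] at this
    exact right_ne_zero_of_mul this

/-- `z` is a Laurent series of the form `t⁻¹ (1 + ⋯)`, the inverse of a parameter at infinity. -/
def IsMonicPole (z : HahnSeries ℤ ℂ) : Prop :=
  ∃ w : PowerSeries ℂ, PowerSeries.constantCoeff w = 1 ∧
    z = HahnSeries.ofPowerSeries ℤ ℂ w * HahnSeries.single (-1) 1

lemma IsMonicPole.coeff_pow {z : HahnSeries ℤ ℂ} (hz : IsMonicPole z) (i : ℕ) :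
    (z ^ i).coeff (-(i : ℤ)) = 1 ∧ ∀ k : ℤ, k < -(i : ℤ) → (z ^ i).coeff k = 0 := by
  obtain ⟨w, hw, rfl⟩ := hz
  rw [mul_pow, ← map_pow, HahnSeries.single_pow, one_pow]
  constructor
  · have := HahnSeries.coeff_mul_single_add (r := (1 : ℂ))
      (x := HahnSeries.ofPowerSeries ℤ ℂ (w ^ i)) (a := (0 : ℤ)) (b := i • (-1 : ℤ))
    rw [zero_add, mul_one] at this
    have h2 := HahnSeries.ofPowerSeries_apply_coeff (Γ := ℤ) (w ^ i) 0
    simp only [Nat.cast_zero] at h2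
    rw [h2] at this
    simpa [hw] using this
  · intro k hk
    have := HahnSeries.coeff_mul_single_add (r := (1 : ℂ))
      (x := HahnSeries.ofPowerSeries ℤ ℂ (w ^ i)) (a := k + i) (b := i • (-1 : ℤ))
    rw [show k + i + i • (-1 : ℤ) = k by simp] at this
    rw [this, mul_one, HahnSeries.ofPowerSeries_apply]
    apply HahnSeries.embDomain_of_notMem_range
    rintro ⟨m, hm⟩
    simp at hm
    omega

lemma IsMonicPole.coeff_aeval {z : HahnSeries ℤ ℂ} (hz : IsMonicPole z) (h : ℂ[X]) :
    (aeval z h).coeff (-(h.natDegree : ℤ)) = h.leadingCoeff ∧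
      ∀ k : ℤ, k < -(h.natDegree : ℤ) → (aeval z h).coeff k = 0 := by
  rw [aeval_def, eval₂_eq_sum_range]
  constructor
  · rw [HahnSeries.coeff_sum, Finset.sum_range_succ, Finset.sum_eq_zero, zero_add,
      algebraMap_mul_coeff, (hz.coeff_pow _).1, mul_one, leadingCoeff]
    intro i hi
    rw [algebraMap_mul_coeff, (hz.coeff_pow i).2, mul_zero]
    rw [Finset.mem_range] at hi
    omega
  · intro k hk
    rw [HahnSeries.coeff_sum]
    apply Finset.sum_eq_zero
    intro i hi
    rw [Finset.mem_range] at hi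
    rw [algebraMap_mul_coeff, (hz.coeff_pow i).2, mul_zero]
    omega

lemma IsMonicPole.aeval_ne_zero {z : HahnSeries ℤ ℂ} (hz : IsMonicPole z) {h : ℂ[X]}
    (hh : h ≠ 0) : aeval z h ≠ 0 := by
  intro h0
  have := (hz.coeff_aeval h).1
  rw [h0] at this
  exact hh (leadingCoeff_eq_zero.mp this.symm)

lemma IsMonicPole.aeval_injective {z : HahnSeries ℤ ℂ} (hz : IsMonicPole z) :
    Function.Injective (aeval z : ℂ[X] →ₐ[ℂ] HahnSeries ℤ ℂ) := by
  rw [injective_iff_map_eq_zero]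
  intro h h0
  by_contra hh
  exact hz.aeval_ne_zero hh h0

lemma IsMonicPole.order_aeval {z : HahnSeries ℤ ℂ} (hz : IsMonicPole z) (h : ℂ[X]) :
    (aeval z h).order = -(h.natDegree : ℤ) := by
  by_cases hh : h = 0
  · simp [hh]
  obtain ⟨h1, h2⟩ := hz.coeff_aeval h
  apply le_antisymm
  · apply HahnSeries.order_le_of_coeff_ne_zero
    rw [h1]
    simpa using hh
  · by_contra hlt
    push Not at hlt
    exact HahnSeries.coeff_order_eq_zero.not.mpr (hz.aeval_ne_zero hh) (h2 _ hlt)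

/-- The leading term of `h(z)` is a nonzero multiple of `t ^ (-deg h)`, which the twist multiplies
by `ω ^ (-deg h)`. -/
lemma IsMonicPole.pow_natDegree_eq_one {z : HahnSeries ℤ ℂ} (hz : IsMonicPole z) {h : ℂ[X]}
    (hh : h ≠ 0) {ω : ℂˣ} (hω : twist ω (aeval z h) = aeval z h) : ω ^ h.natDegree = 1 := by
  have h1 := (hz.coeff_aeval h).1
  have h2 := h1
  rw [← hω, twist_coeff, h1, mul_eq_right₀ (by simpa using hh)] at h2
  have h3 : ω ^ (-(h.natDegree : ℤ)) = 1 := Units.ext h2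
  simpa using h3

/-- Every nonconstant polynomial becomes a monomial in a suitable parameter at infinity. -/
lemma exists_isMonicPole (P : ℂ[X]) (hP : 1 ≤ P.natDegree) :
    ∃ z : HahnSeries ℤ ℂ, IsMonicPole z ∧
      aeval z P = HahnSeries.single (-(P.natDegree : ℤ)) P.leadingCoeff := by
  have hP0 : P ≠ 0 := by rintro rfl; simp at hP
  set c := P.leadingCoeff with hc
  have hc0 : c ≠ 0 := by simpa [hc] using hP0
  set n := P.natDegree with hn
  set M : ℂ[X] := P * C c⁻¹ with hM
  have hMm : M.Monic := monic_mul_leadingCoeff_inv hP0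
  have hMn : M.natDegree = n := natDegree_mul_C (inv_ne_zero hc0)
  set N : (PowerSeries ℂ)[X] := M.map PowerSeries.C with hN
  have hNm : N.Monic := hMm.map _
  have hNn : N.natDegree = n := by rw [hN, hMm.natDegree_map, hMn]
  -- With `M` the monic multiple of `P`, this is `tⁿ M(T/t) - 1`. It reduces to `Tⁿ - 1` modulo `t`,
  -- so Hensel lifts the simple root `1` to a series `w`, and `z = w/t` satisfies `M(z) = t⁻ⁿ`.
  set f : (PowerSeries ℂ)[X] := scaleRoots N PowerSeries.X - C 1 with hf
  have hSm : (scaleRoots N PowerSeries.X).Monic := (monic_scaleRoots_iff _).mpr hNm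
  have hSn : (scaleRoots N PowerSeries.X).natDegree = n := by rw [natDegree_scaleRoots, hNn]
  have hfm : f.Monic := by
    apply hSm.sub_of_left
    rw [degree_C one_ne_zero, degree_eq_natDegree hSm.ne_zero, hSn]
    exact_mod_cast hP
  have hmap : f.map PowerSeries.constantCoeff = X ^ n - C 1 := by
    rw [hf, Polynomial.map_sub, map_C, map_one]
    congr 1
    ext i
    rw [coeff_map, coeff_scaleRoots, hNn, coeff_X_pow, map_mul, map_pow,
      PowerSeries.constantCoeff_X, hN, coeff_map]
    split_ifs with hi
    · rw [hi, Nat.sub_self, ← hMn, hMm.coeff_natDegree]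
      simp
    · rcases lt_or_gt_of_ne hi with h | h
      · rw [zero_pow (by omega), mul_zero]
      · rw [coeff_eq_zero_of_natDegree_lt (hMn ▸ h)]
        simp
  have hmem : ∀ x : PowerSeries ℂ, x ∈ Ideal.span {(PowerSeries.X : PowerSeries ℂ)} ↔
      PowerSeries.constantCoeff x = 0 := by
    intro x
    rw [Ideal.mem_span_singleton, PowerSeries.X_dvd_iff]
  obtain ⟨w, hw, hw1⟩ := HenselianRing.is_henselian
    (I := Ideal.span {(PowerSeries.X : PowerSeries ℂ)}) f hfm 1
    (by
      rw [hmem, ← eval_map_apply, hmap]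
      simp)
    (by
      apply IsUnit.map
      rw [PowerSeries.isUnit_iff_constantCoeff, ← eval_map_apply, ← derivative_map, hmap]
      simp [derivative_X_pow]
      omega)
  rw [hmem, map_sub, map_one, sub_eq_zero] at hw1
  refine ⟨HahnSeries.ofPowerSeries ℤ ℂ w * HahnSeries.single (-1) 1, ⟨w, hw1, rfl⟩, ?_⟩
  set z : HahnSeries ℤ ℂ := HahnSeries.ofPowerSeries ℤ ℂ w * HahnSeries.single (-1) 1 with hz
  have hXz : HahnSeries.ofPowerSeries ℤ ℂ PowerSeries.X * z = HahnSeries.ofPowerSeries ℤ ℂ w := by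
    rw [hz, mul_left_comm, HahnSeries.ofPowerSeries_X, HahnSeries.single_mul_single]
    simp
  have key := scaleRoots_eval₂_mul (p := N) (HahnSeries.ofPowerSeries ℤ ℂ) z PowerSeries.X
  rw [hXz, eval₂_at_apply] at key
  have hw2 : (scaleRoots N PowerSeries.X).eval w = 1 := by
    rw [hf] at hw
    simpa [sub_eq_zero] using hw
  have hcomp : eval₂ (HahnSeries.ofPowerSeries ℤ ℂ) z N = aeval z M := by
    rw [hN, eval₂_map, aeval_def]
    congr 1
  rw [hw2, map_one, hcomp, hNn, HahnSeries.ofPowerSeries_X, HahnSeries.single_pow, one_pow] at key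
  have hPM : P = C c * M := by
    rw [hM, mul_left_comm, ← C_mul, mul_inv_cancel₀ hc0, C_1, mul_one]
  have hMz : aeval z M = HahnSeries.single (-(n : ℤ)) 1 := by
    have : HahnSeries.single (-(n : ℤ)) (1 : ℂ) * HahnSeries.single (n • (1 : ℤ)) 1 = 1 := by
      rw [HahnSeries.single_mul_single]
      simp
    rw [← one_mul (aeval z M), ← this, mul_assoc, ← key, mul_one]
  rw [hPM, map_mul, hMz, aeval_C, algebraMap_hahnSeries_eq_C, HahnSeries.C_apply,
    HahnSeries.single_mul_single]
  simp

/-! ### Invariance under roots of unity and right composition factors -/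

lemma eq_C_mul_prod_filter_of_dvd {F : Type*} [Field F] [DecidableEq F] {p : F[X]} {c : F}
    (hc : c ≠ 0) {S : Finset F} (hp : p ∣ C c * ∏ x ∈ S, (X - C x)) :
    p = C p.leadingCoeff * ∏ x ∈ S with p.eval x = 0, (X - C x) := by
  classical
  have hm : (∏ x ∈ S, (X - C x)).Monic := monic_prod_X_sub_C (fun x : F => x) S
  have h0 : C c * ∏ x ∈ S, (X - C x) ≠ 0 := mul_ne_zero (by simpa using hc) hm.ne_zero
  have hp0 : p ≠ 0 := by
    rintro rfl
    exact h0 (zero_dvd_iff.mp hp)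
  have hs : p.Splits := Splits.of_dvd ((Splits.prod fun x _ => Splits.X_sub_C x).C_mul c) h0 hp
  have hr : (C c * ∏ x ∈ S, (X - C x)).roots = S.val := by
    rw [roots_C_mul _ hc, roots_prod_X_sub_C]
  have hle : p.roots ≤ S.val := hr ▸ roots.le_of_dvd h0 hp
  have hnd : p.roots.Nodup := Multiset.nodup_of_le hle S.nodup
  have hroots : p.roots = (S.filter fun x => p.eval x = 0).val := by
    rw [Multiset.Nodup.ext hnd (Finset.nodup _)]
    intro x
    rw [mem_roots hp0, Finset.mem_val, Finset.mem_filter, IsRoot.def]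
    exact ⟨fun h => ⟨Multiset.mem_of_le hle ((mem_roots hp0).mpr h), h⟩, And.right⟩
  conv_lhs => rw [hs.eq_prod_roots, hroots]
  rfl

/-- The polynomial `h` at `z` is fixed by `t ↦ ω t` for all `d`-th roots of unity `ω`. -/
def IsTwistInvariant (z : HahnSeries ℤ ℂ) (d : ℕ) (h : ℂ[X]) : Prop :=
  ∀ ω : ℂˣ, ω ^ d = 1 → twist ω (aeval z h) = aeval z h

/-- The conjugates of `z` under `t ↦ ω t`, where `ω` is a `d`-th root of unity. -/
noncomputable def conjugates (z : HahnSeries ℤ ℂ) (d : ℕ) [NeZero d] :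
    Finset (HahnSeries ℤ ℂ) :=
  (Set.finite_range fun ω : rootsOfUnity d ℂ => twist ω z).toFinset

lemma mem_conjugates {z x : HahnSeries ℤ ℂ} {d : ℕ} [NeZero d] :
    x ∈ conjugates z d ↔ ∃ ω : ℂˣ, ω ^ d = 1 ∧ twist ω z = x := by
  simp [conjugates, mem_rootsOfUnity]

section

variable {z : HahnSeries ℤ ℂ}

lemma IsMonicPole.twist_injective (hz : IsMonicPole z) :
    Function.Injective fun ω : ℂˣ => twist ω z := by
  intro ω η h
  have h1 : twist (η⁻¹ * ω) z = z := by
    have := congrArg (twist η⁻¹) h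
    simp only [twist_twist, inv_mul_cancel] at this
    rw [this, twist_one]
  have := hz.pow_natDegree_eq_one (h := X) X_ne_zero (by rw [aeval_X]; exact h1)
  rw [natDegree_X, pow_one] at this
  exact (inv_mul_eq_one.mp this).symm

lemma IsMonicPole.card_conjugates (hz : IsMonicPole z) (d : ℕ) [NeZero d] :
    (conjugates z d).card = d := by
  rw [conjugates, ← Set.ncard_eq_toFinset_card _ (Set.finite_range _), ← Nat.card_coe_set_eq,
    Nat.card_range_of_injective fun ω η h => Subtype.ext (hz.twist_injective h),
    Complex.card_rootsOfUnity]

lemma IsTwistInvariant.dvd_natDegree (hz : IsMonicPole z) {d : ℕ} [NeZero d] {h : ℂ[X]}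
    (hh : IsTwistInvariant z d h) : d ∣ h.natDegree := by
  by_cases h0 : h = 0
  · simp [h0]
  have hζ := IsPrimitiveRoot.isUnit_unit (NeZero.ne d)
    (Complex.isPrimitiveRoot_exp d (NeZero.ne d))
  exact hζ.dvd_of_pow_eq_one _ (hz.pow_natDegree_eq_one h0 (hh _ hζ.pow_eq_one))

lemma IsTwistInvariant.mono {d e : ℕ} (hde : d ∣ e) {h : ℂ[X]} (hh : IsTwistInvariant z e h) :
    IsTwistInvariant z d h := by
  intro ω hω
  obtain ⟨k, rfl⟩ := hde
  exact hh ω (by rw [pow_mul, hω, one_pow])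

/-- By Bézout, an `ab`-th root of unity is the product of an `a`-th and a `b`-th root of unity. -/
lemma IsTwistInvariant.mul_of_coprime {a b : ℕ} (hab : a.Coprime b) {h : ℂ[X]}
    (ha : IsTwistInvariant z a h) (hb : IsTwistInvariant z b h) :
    IsTwistInvariant z (a * b) h := by
  intro ω hω
  have hbez := Nat.gcd_eq_gcd_ab a b
  rw [hab, Nat.cast_one] at hbez
  have h1 : ω = (ω ^ ((b : ℤ) * a.gcdB b)) * ω ^ ((a : ℤ) * a.gcdA b) := by
    rw [← zpow_add, add_comm, ← hbez, zpow_one]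
  have h2 : ω ^ ((a : ℤ) * b) = 1 := by exact_mod_cast hω
  rw [h1, ← twist_twist, hb, ha]
  · rw [← zpow_natCast, ← zpow_mul, show (b : ℤ) * a.gcdB b * a = a * b * a.gcdB b by ring,
      zpow_mul, h2, one_zpow]
  · rw [← zpow_natCast, ← zpow_mul, show (a : ℤ) * a.gcdA b * b = a * b * a.gcdA b by ring,
      zpow_mul, h2, one_zpow]

lemma IsTwistInvariant.comp {d : ℕ} {A : ℂ[X]} (hA : IsTwistInvariant z d A) (U : ℂ[X]) :
    IsTwistInvariant z d (U.comp A) := by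
  intro ω hω
  rw [aeval_comp, ← aeval_algHom_apply, hA ω hω]

/-- Invariance forces `d` to divide the degree of `h`, so a multiple of a power of `A` cancels the
leading term; the difference is again invariant and of smaller degree. -/
lemma IsTwistInvariant.exists_comp (hz : IsMonicPole z) {d : ℕ} [NeZero d] {A : ℂ[X]}
    (hA : IsTwistInvariant z d A) (hAd : A.natDegree = d) {h : ℂ[X]}
    (hh : IsTwistInvariant z d h) : ∃ U : ℂ[X], h = U.comp A := by
  induction hn : h.natDegree using Nat.strong_induction_on generalizing h with
  | _ n ih =>
    rcases Nat.eq_zero_or_pos n with h0 | hpos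
    · rw [h0] at hn
      rw [eq_C_of_natDegree_eq_zero hn]
      exact ⟨C (h.coeff 0), by simp⟩
    obtain ⟨k, hk⟩ := hh.dvd_natDegree hz
    have hA0 : A ≠ 0 := by
      rintro rfl
      exact NeZero.ne d (by simpa using hAd.symm)
    set V : ℂ[X] := C (h.leadingCoeff / A.leadingCoeff ^ k) * X ^ k with hV
    have hVA : V.comp A = C (h.leadingCoeff / A.leadingCoeff ^ k) * A ^ k := by simp [hV]
    have hlA : A.leadingCoeff ^ k ≠ 0 := pow_ne_zero _ (by simpa using hA0)
    have hh0 : h ≠ 0 := by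
      rintro rfl
      simp at hn
      omega
    have hlh : h.leadingCoeff ≠ 0 := by simpa using hh0
    have hlt : (h - V.comp A).natDegree < n := by
      rw [← hn]
      have hd : (V.comp A).natDegree = h.natDegree := by
        rw [hVA, natDegree_C_mul (div_ne_zero hlh hlA), natDegree_pow, hAd, hk, mul_comm]
      have hl : h.leadingCoeff = (V.comp A).leadingCoeff := by
        rw [hVA, leadingCoeff_mul, leadingCoeff_C, leadingCoeff_pow, div_mul_cancel₀ _ hlA]
      by_cases hs : h - V.comp A = 0
      · rw [hs, natDegree_zero]
        omega
      · apply natDegree_lt_natDegree hs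
        refine degree_sub_lt_left ?_ hh0 hl
        rw [degree_eq_natDegree hh0, ← hd, degree_eq_natDegree]
        rw [← leadingCoeff_ne_zero, ← hl]
        exact hlh
    have hinv : IsTwistInvariant z d (h - V.comp A) := by
      intro ω hω
      rw [map_sub, map_sub, hh ω hω, hA.comp V ω hω]
    obtain ⟨W, hW⟩ := ih _ hlt hinv rfl
    exact ⟨W + V, by rw [add_comp, ← hW, sub_add_cancel]⟩

lemma isTwistInvariant_of_aeval_eq_single {P : ℂ[X]} {c : ℂ}
    (hP : aeval z P = HahnSeries.single (-(P.natDegree : ℤ)) c) :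
    IsTwistInvariant z P.natDegree P := by
  intro ω hω
  ext k
  rw [twist_coeff, hP, HahnSeries.coeff_single]
  split_ifs with hk
  · rw [hk, zpow_neg, zpow_natCast, hω]
    simp
  · simp

/-- The conjugates of `z` are the roots of `A(T) - A(z)`. -/
lemma IsTwistInvariant.map_sub_eq (hz : IsMonicPole z) {d : ℕ} [NeZero d] {A : ℂ[X]}
    (hA : IsTwistInvariant z d A) (hAd : A.natDegree = d) :
    A.map (algebraMap ℂ (HahnSeries ℤ ℂ)) - C (aeval z A) =
      C (algebraMap ℂ (HahnSeries ℤ ℂ) A.leadingCoeff) * ∏ x ∈ conjugates z d, (X - C x) := by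
  set f := A.map (algebraMap ℂ (HahnSeries ℤ ℂ)) - C (aeval z A) with hf
  have hd : 0 < A.natDegree := hAd ▸ Nat.pos_of_ne_zero (NeZero.ne d)
  have hmd : (A.map (algebraMap ℂ (HahnSeries ℤ ℂ))).natDegree = A.natDegree := natDegree_map _
  have hfd : f.natDegree = d := by rw [hf, natDegree_sub_C, hmd, hAd]
  have hlc : f.leadingCoeff = algebraMap ℂ (HahnSeries ℤ ℂ) A.leadingCoeff := by
    rw [hf, leadingCoeff_sub_of_degree_lt, leadingCoeff_map]
    refine degree_C_le.trans_lt ?_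
    rw [← natDegree_pos_iff_degree_pos, hmd]
    exact hd
  rw [← hlc]
  apply eq_leadingCoeff_mul_of_monic_of_dvd_of_natDegree_le
  · exact monic_prod_X_sub_C (fun x => x) _
  · apply Finset.prod_dvd_of_coprime
    · exact (pairwise_coprime_X_sub_C (s := fun x : HahnSeries ℤ ℂ => x)
        Function.injective_id).set_pairwise _
    · intro x hx
      obtain ⟨ω, hω, rfl⟩ := mem_conjugates.mp hx
      rw [dvd_iff_isRoot, IsRoot.def, hf, eval_sub, eval_C, eval_map_algebraMap,
        aeval_algHom_apply, hA ω hω, sub_self]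
  · rw [hfd, natDegree_finsetProd_X_sub_C_eq_card _ (fun x => x), hz.card_conjugates]

/-- Right composition factors are invariant. -/
lemma IsTwistInvariant.of_comp (hz : IsMonicPole z) {n a : ℕ} [NeZero n] [NeZero a]
    {U A : ℂ[X]} (hP : IsTwistInvariant z n (U.comp A)) (hPn : (U.comp A).natDegree = n)
    (ha : A.natDegree = a) : IsTwistInvariant z a A := by
  classical
  have hU0 : U.comp A ≠ 0 := by
    intro h
    rw [h] at hPn
    exact NeZero.ne n (by simpa using hPn.symm)
  have hA0 : A ≠ 0 := by
    rintro rfl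
    exact NeZero.ne a (by simpa using ha.symm)
  set f := A.map (algebraMap ℂ (HahnSeries ℤ ℂ)) - C (aeval z A) with hf
  -- `Y - Y'` divides `U(Y) - U(Y')`, here with `Y = A(T)` and `Y' = A(z)`.
  have hdvd : f ∣ (U.comp A).map (algebraMap ℂ (HahnSeries ℤ ℂ)) - C (aeval z (U.comp A)) := by
    have := sub_dvd_eval_sub (A.map (algebraMap ℂ (HahnSeries ℤ ℂ))) (C (aeval z A))
      ((U.map (algebraMap ℂ (HahnSeries ℤ ℂ))).map C)
    rw [eval_map, eval_map, eval₂_at_apply, eval_map_algebraMap, ← aeval_comp] at this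
    rwa [map_comp]
  rw [hP.map_sub_eq hz hPn] at hdvd
  have hfac := eq_C_mul_prod_filter_of_dvd (by simpa using hU0) hdvd
  have hfd : f.natDegree = a := by rw [hf, natDegree_sub_C, natDegree_map, ha]
  have hf0 : f ≠ 0 := by
    intro h
    rw [h] at hfd
    exact NeZero.ne a (by simpa using hfd.symm)
  set S := (conjugates z n).filter fun x => f.eval x = 0 with hS
  have hcard : S.card = a := by
    have := congrArg natDegree hfac
    rwa [natDegree_C_mul (by simpa using hf0), hfd,
      natDegree_finsetProd_X_sub_C_eq_card _ (fun x => x), eq_comm] at this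
  have hroot : ∀ ω : ℂˣ, f.eval (twist ω z) = 0 ↔ twist ω (aeval z A) = aeval z A := by
    intro ω
    rw [hf, eval_sub, eval_C, eval_map_algebraMap, aeval_algHom_apply, sub_eq_zero]
  have hsub : S ⊆ conjugates z a := by
    intro x hx
    obtain ⟨hx1, hx2⟩ := Finset.mem_filter.mp hx
    obtain ⟨ω, hω, rfl⟩ := mem_conjugates.mp hx1
    exact mem_conjugates.mpr
      ⟨ω, ha ▸ hz.pow_natDegree_eq_one hA0 ((hroot ω).mp hx2), rfl⟩
  -- The roots of `f` are simple and number `a`, and all lie among the `a` conjugates by `a`-th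
  -- roots of unity.
  have heq : S = conjugates z a :=
    Finset.eq_of_subset_of_card_le hsub (by rw [hz.card_conjugates, hcard])
  intro ω hω
  have : twist ω z ∈ S := heq ▸ mem_conjugates.mpr ⟨ω, hω, rfl⟩
  exact (hroot ω).mp (Finset.mem_filter.mp this).2

/-! ### Common right factors and common left multiples -/

lemma order_prod_conjugates (hz : IsMonicPole z) (s : Finset (HahnSeries ℤ ℂ))
    (hs : ∀ x ∈ s, ∃ ω : ℂˣ, twist ω z = x) :
    (∏ x ∈ s, -x) ≠ 0 ∧ (∏ x ∈ s, -x).order = -(s.card : ℤ) := by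
  classical
  have hz0 : z ≠ 0 := by simpa using hz.aeval_ne_zero X_ne_zero
  have hzo : z.order = -1 := by simpa using hz.order_aeval X
  induction s using Finset.induction_on with
  | empty => simp
  | insert x s hx ih =>
    obtain ⟨h0, h1⟩ := ih fun y hy => hs y (Finset.mem_insert_of_mem hy)
    obtain ⟨ω, rfl⟩ := hs x (Finset.mem_insert_self _ _)
    have hx0 : -twist ω z ≠ 0 := by simpa using hz0
    rw [Finset.prod_insert hx]
    refine ⟨mul_ne_zero hx0 h0, ?_⟩
    rw [HahnSeries.order_mul hx0 h0, h1, HahnSeries.order_neg, twist_order, hzo,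
      Finset.card_insert_of_notMem hx]
    push_cast
    ring

lemma twist_prod_conjugates {d : ℕ} [NeZero d] {ω : ℂˣ} (hω : ω ^ d = 1) :
    twist ω (∏ x ∈ conjugates z d, -x) = ∏ x ∈ conjugates z d, -x := by
  rw [map_prod]
  refine Finset.prod_nbij' (twist ω) (twist ω⁻¹) ?_ ?_ ?_ ?_ ?_
  · intro x hx
    obtain ⟨η, hη, rfl⟩ := mem_conjugates.mp hx
    exact mem_conjugates.mpr ⟨ω * η, by rw [mul_pow, hω, hη, one_mul], (twist_twist _ _ _).symm⟩
  · intro x hx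
    obtain ⟨η, hη, rfl⟩ := mem_conjugates.mp hx
    exact mem_conjugates.mpr
      ⟨ω⁻¹ * η, by rw [mul_pow, inv_pow, hω, hη, inv_one, one_mul], (twist_twist _ _ _).symm⟩
  · intro x _
    rw [twist_twist, inv_mul_cancel, twist_one]
  · intro x _
    rw [twist_twist, mul_inv_cancel, twist_one]
  · intro x _
    rw [map_neg]

lemma eq_of_mul_C_eq {F : Type*} [Field F] {p q r : F[X]} {c : F} (hc : c ≠ 0)
    (h1 : p * C c = r) (h2 : r = C c * q) : p = q :=
  mul_left_cancel₀ (C_ne_zero.mpr hc) ((mul_comm _ _).trans (h1.trans h2))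

lemma exists_comp_algebraMap_eq {R L : Type*} (K : Type*) [CommRing R] [Field K] [Algebra R K]
    [IsFractionRing R K] [Field L] (ι : R →+* L) (hι : Function.Injective ι) :
    ∃ ψ : K →+* L, ψ.comp (algebraMap R K) = ι :=
  ⟨IsFractionRing.lift hι, RingHom.ext fun x => IsFractionRing.lift_algebraMap hι x⟩

/-- Two invariant polynomials have a common right factor whose degree is the greatest common
divisor of their degrees. -/
lemma exists_isTwistInvariant_gcd (K : Type*) [Field K] [Algebra ℂ[X] K] [IsFractionRing ℂ[X] K]
    (hz : IsMonicPole z) {a b : ℕ} [NeZero a] [NeZero b]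
    {A B : ℂ[X]} (hA : IsTwistInvariant z a A) (hAa : A.natDegree = a)
    (hB : IsTwistInvariant z b B) (hBb : B.natDegree = b) :
    ∃ E : ℂ[X], IsTwistInvariant z (a.gcd b) E ∧ E.natDegree = a.gcd b := by
  classical
  have : NeZero (a.gcd b) := ⟨Nat.gcd_ne_zero_left (NeZero.ne a)⟩
  set ι : ℂ[X] →+* HahnSeries ℤ ℂ := (aeval z : ℂ[X] →ₐ[ℂ] HahnSeries ℤ ℂ).toRingHom with hι
  obtain ⟨ψ, hψι⟩ : ∃ ψ : K →+* HahnSeries ℤ ℂ, ψ.comp (algebraMap ℂ[X] K) = ι :=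
    exists_comp_algebraMap_eq K ι hz.aeval_injective
  have hιC : ι.comp C = algebraMap ℂ (HahnSeries ℤ ℂ) := by
    ext1 r
    simp [hι]
  have hA0 : A.leadingCoeff ≠ 0 := by
    rw [Ne, leadingCoeff_eq_zero]
    rintro rfl
    exact NeZero.ne a (by simpa using hAa.symm)
  have hmapι : ∀ Q : ℂ[X], (Q.map C - C Q).map ι =
      Q.map (algebraMap ℂ (HahnSeries ℤ ℂ)) - C (aeval z Q) := by
    intro Q
    rw [Polynomial.map_sub, map_map, hιC, map_C]
    rfl
  have hmapψ : ∀ Q : ℂ[X], ((Q.map C - C Q).map (algebraMap ℂ[X] K)).map ψ =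
      Q.map (algebraMap ℂ (HahnSeries ℤ ℂ)) - C (aeval z Q) := by
    intro Q
    rw [map_map, hψι, hmapι]
  set D : K[X] := EuclideanDomain.gcd ((A.map C - C A).map (algebraMap ℂ[X] K))
    ((B.map C - C B).map (algebraMap ℂ[X] K)) with hD
  have hDA : D ∣ (A.map C - C A).map (algebraMap ℂ[X] K) := EuclideanDomain.gcd_dvd_left _ _
  have hDF : D.map ψ ∣ C (algebraMap ℂ (HahnSeries ℤ ℂ) A.leadingCoeff) *
      ∏ x ∈ conjugates z a, (X - C x) := by
    rw [← hA.map_sub_eq hz hAa, ← hmapψ]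
    exact Polynomial.map_dvd ψ hDA
  have hfac := eq_C_mul_prod_filter_of_dvd (by simpa using hA0) hDF
  -- A conjugate of `z` is a common root exactly when `ω` is both an `a`-th and a `b`-th root of
  -- unity.
  have hS : ((conjugates z a).filter fun x => (D.map ψ).eval x = 0) = conjugates z (a.gcd b) := by
    ext x
    have hroot : ∀ (ω : ℂˣ) (Q : ℂ[X]),
        eval₂ ψ (twist ω z) ((Q.map C - C Q).map (algebraMap ℂ[X] K)) = 0 ↔
          twist ω (aeval z Q) = aeval z Q := by
      intro ω Q
      rw [← eval_map, hmapψ, eval_sub, eval_C, eval_map_algebraMap, aeval_algHom_apply,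
        sub_eq_zero]
    rw [Finset.mem_filter, mem_conjugates, mem_conjugates]
    constructor
    · rintro ⟨⟨ω, hω, rfl⟩, hr⟩
      refine ⟨ω, ?_, rfl⟩
      rw [eval_map, hD, root_gcd_iff_root_left_right, hroot, hroot] at hr
      have hB0 : B ≠ 0 := by
        rintro rfl
        exact NeZero.ne b (by simpa using hBb.symm)
      have hωb : ω ^ b = 1 := hBb ▸ hz.pow_natDegree_eq_one hB0 hr.2
      rw [← orderOf_dvd_iff_pow_eq_one] at *
      exact Nat.dvd_gcd hω hωb
    · rintro ⟨ω, hω, rfl⟩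
      have h1 : ω ^ a = 1 := by
        rw [← orderOf_dvd_iff_pow_eq_one] at *
        exact hω.trans (Nat.gcd_dvd_left _ _)
      refine ⟨⟨ω, h1, rfl⟩, ?_⟩
      rw [eval_map, hD, root_gcd_iff_root_left_right, hroot, hroot]
      exact ⟨hA.mono (Nat.gcd_dvd_left _ _) ω hω, hB.mono (Nat.gcd_dvd_right _ _) ω hω⟩
  rw [hS] at hfac
  set M : ℂ[X][X] := C (C A.leadingCoeff⁻¹) * (A.map C - C A) with hM
  have hMm : M.Monic := by
    have hlc : (A.map C - C A : ℂ[X][X]).leadingCoeff = C A.leadingCoeff := by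
      rw [leadingCoeff_sub_of_degree_lt, leadingCoeff_map]
      refine degree_C_le.trans_lt ?_
      rw [← natDegree_pos_iff_degree_pos, natDegree_map, hAa]
      exact Nat.pos_of_ne_zero (NeZero.ne a)
    rw [Monic, hM, leadingCoeff_mul, hlc, leadingCoeff_C, ← C_mul, inv_mul_cancel₀ hA0, C_1]
  -- Gauss's lemma: up to a constant of `K`, a divisor over `K` of a monic polynomial over `ℂ[X]`
  -- has coefficients in `ℂ[X]`. The constant coefficient of `G` is then a genuine polynomial `E`.
  obtain ⟨G, hG⟩ := IsIntegrallyClosed.eq_map_mul_C_of_dvd K hMm (g := D) (by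
    rw [hM, Polynomial.map_mul]
    exact hDA.mul_left _)
  have hD0 : D ≠ 0 := by
    intro h
    rw [h, zero_dvd_iff, ← Polynomial.map_eq_zero ψ, hmapψ, hA.map_sub_eq hz hAa] at hDA
    exact mul_ne_zero (by simpa using hA0) (monic_prod_X_sub_C (fun x => x) _).ne_zero hDA
  have hGF : G.map ι = ∏ x ∈ conjugates z (a.gcd b), (X - C x) := by
    have hlc : ψ D.leadingCoeff ≠ 0 := by
      rw [Ne, map_eq_zero, leadingCoeff_eq_zero]
      exact hD0
    have h1 := congrArg (Polynomial.map ψ) hG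
    rw [Polynomial.map_mul, map_map, hψι, map_C] at h1
    rw [leadingCoeff_map] at hfac
    exact eq_of_mul_C_eq hlc h1 hfac
  -- The product is permuted by the twists, and each factor has order `-1`: this gives the
  -- invariance and the degree of `E`.
  have hE : aeval z (G.coeff 0) = ∏ x ∈ conjugates z (a.gcd b), -x := by
    have h1 := congrArg (fun p => p.eval 0) hGF
    simp only [eval_prod, eval_sub, eval_X, eval_C, zero_sub, ← coeff_zero_eq_eval_zero,
      coeff_map] at h1
    exact h1
  refine ⟨G.coeff 0, ?_, ?_⟩
  · intro ω hω
    rw [hE, twist_prod_conjugates hω]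
  · have h1 := (order_prod_conjugates hz (conjugates z (a.gcd b)) fun x hx => by
      obtain ⟨ω, -, h⟩ := mem_conjugates.mp hx
      exact ⟨ω, h⟩).2
    rw [← hE, hz.order_aeval, hz.card_conjugates] at h1
    omega

/-- Two invariant polynomials have a common left multiple. -/
lemma exists_isTwistInvariant_mul (hz : IsMonicPole z) {a b : ℕ} [NeZero a] [NeZero b]
    {A B : ℂ[X]} (hA : IsTwistInvariant z a A) (hAa : A.natDegree = a)
    (hB : IsTwistInvariant z b B) (hBb : B.natDegree = b) :
    ∃ D : ℂ[X], IsTwistInvariant z a D ∧ IsTwistInvariant z b D ∧ D.natDegree = a * b := by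
  -- The product of `B - B(r)` over the roots `r` of `A`, a resultant; it is a polynomial in `B` by
  -- construction.
  set D : ℂ[X] := (A.roots.map fun r => X - C (B.eval r)).prod.comp B with hD
  refine ⟨D, ?_, hB.comp _, ?_⟩
  · have hsplit : A = C A.leadingCoeff * (A.roots.map fun r => X - C r).prod :=
      (IsAlgClosed.splits A).eq_prod_roots
    have hlA : algebraMap ℂ (HahnSeries ℤ ℂ) A.leadingCoeff ≠ 0 := by
      rw [Ne, map_eq_zero, leadingCoeff_eq_zero]
      rintro rfl
      exact NeZero.ne a (by simpa using hAa.symm)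
    set g : HahnSeries ℤ ℂ → HahnSeries ℤ ℂ := fun x =>
      (A.roots.map fun r => x - algebraMap ℂ (HahnSeries ℤ ℂ) r).prod with hg
    have hgA : ∀ x, algebraMap ℂ (HahnSeries ℤ ℂ) A.leadingCoeff * g x = aeval x A := by
      intro x
      conv_rhs => rw [hsplit]
      rw [map_mul, aeval_C, map_multiset_prod, Multiset.map_map]
      simp [hg]
    set k : HahnSeries ℤ ℂ :=
      algebraMap ℂ (HahnSeries ℤ ℂ) B.leadingCoeff * (-1) ^ (b + 1) with hk
    -- Factoring each `B(z) - B(r)` and exchanging the products turns `D(z)`, up to constants, into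
    -- the product of `A(x)` over the conjugates `x = z(ηt)`. Each factor is fixed by `a`-th roots
    -- of unity, since twists commute.
    have hBr : ∀ r : ℂ, aeval z B - algebraMap ℂ (HahnSeries ℤ ℂ) (B.eval r) =
        k * ∏ x ∈ conjugates z b, (x - algebraMap ℂ (HahnSeries ℤ ℂ) r) := by
      intro r
      have h1 := congrArg (eval (algebraMap ℂ (HahnSeries ℤ ℂ) r)) (hB.map_sub_eq hz hBb)
      simp only [eval_sub, eval_mul, eval_C, eval_prod, eval_X, eval_map_algebraMap,
        aeval_algebraMap_apply_eq_algebraMap_eval] at h1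
      have h2 : ∏ x ∈ conjugates z b, (algebraMap ℂ (HahnSeries ℤ ℂ) r - x) =
          (-1) ^ b * ∏ x ∈ conjugates z b, (x - algebraMap ℂ (HahnSeries ℤ ℂ) r) := by
        have h3 : (-1 : HahnSeries ℤ ℂ) ^ b = ∏ x ∈ conjugates z b, (-1) := by
          rw [Finset.prod_const, hz.card_conjugates]
        rw [h3, ← Finset.prod_mul_distrib]
        exact Finset.prod_congr rfl fun x _ => by ring
      rw [h2] at h1
      rw [← neg_sub, h1, hk, pow_succ]
      ring
    have hDz : aeval z D = k ^ A.roots.card * ∏ x ∈ conjugates z b, g x := by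
      rw [hg, ← Multiset.prod_map_prod, ← Multiset.prod_replicate, ← Multiset.map_const',
        ← Multiset.prod_map_mul, hD, aeval_comp, map_multiset_prod, Multiset.map_map]
      congr 1
      refine Multiset.map_congr rfl fun r _ => ?_
      rw [← hBr]
      simp
    intro ω hω
    have hkω : twist ω k = k := by
      rw [hk, map_mul, AlgHom.commutes, map_pow, map_neg, map_one]
    rw [hDz, map_mul, map_pow, hkω, map_prod]
    congr 1
    refine Finset.prod_congr rfl fun x hx => ?_
    obtain ⟨η, hη, rfl⟩ := mem_conjugates.mp hx
    have h1 := congrArg (twist ω) (hgA (twist η z))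
    rw [map_mul, AlgHom.commutes, aeval_algHom_apply, twist_twist, mul_comm ω η, ← twist_twist,
      hA ω hω, ← aeval_algHom_apply, ← hgA] at h1
    exact mul_left_cancel₀ hlA h1
  · have hmm : (A.roots.map fun r => X - C (B.eval r)) =
        (A.roots.map fun r => B.eval r).map fun r => X - C r := by
      rw [Multiset.map_map]
      rfl
    rw [hD, natDegree_comp, hmm, natDegree_multiset_prod_X_sub_C_eq_card, Multiset.card_map,
      ← (IsAlgClosed.splits A).natDegree_eq_card_roots, hAa, hBb]

end

/-! ### Two prime right factors of one polynomial -/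

lemma comp_right_cancel {U V A : ℂ[X]} (hA : A.natDegree ≠ 0) (h : U.comp A = V.comp A) :
    U = V := by
  have h1 : (U - V).comp A = 0 := by rw [sub_comp, h, sub_self]
  rcases comp_eq_zero_iff.mp h1 with h2 | ⟨-, h2⟩
  · exact sub_eq_zero.mp h2
  · rw [h2, natDegree_C] at hA
    exact absurd rfl hA

/-- If `U = U₁ ∘ U₂`, then `U₂ ∘ A` is a right factor of the whole polynomial. Its common right
factor with `B` has degree `deg U₂` because `a` and `b` are coprime, so primality of `B` makes `U₁`
or `U₂` linear. -/
lemma isPrimePoly_of_twistInvariant {z : HahnSeries ℤ ℂ} (hz : IsMonicPole z) {n a b : ℕ}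
    [NeZero n] [NeZero a] [NeZero b] {W U A B : ℂ[X]}
    (hP : IsTwistInvariant z n ((W.comp U).comp A)) (hPn : ((W.comp U).comp A).natDegree = n)
    (ha : A.natDegree = a) (hB : IsTwistInvariant z b B) (hb : B.natDegree = b)
    (hBp : IsPrimePoly B) (hab : a.Coprime b) (hU : U.natDegree = b) : IsPrimePoly U := by
  intro U₁ U₂ h12
  have hdeg : b = U₁.natDegree * U₂.natDegree := by rw [← hU, h12, natDegree_comp]
  have hb0 := NeZero.ne b
  have h2 : U₂.natDegree ≠ 0 := by
    intro h
    rw [h, mul_zero] at hdeg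
    exact hb0 hdeg
  have : NeZero U₂.natDegree := ⟨h2⟩
  have hda : (U₂.comp A).natDegree = U₂.natDegree * a := by rw [natDegree_comp, ha]
  have : NeZero (U₂.natDegree * a) := ⟨mul_ne_zero h2 (NeZero.ne a)⟩
  have hassoc : (W.comp U).comp A = (W.comp U₁).comp (U₂.comp A) := by
    rw [h12, comp_assoc, comp_assoc, comp_assoc]
  rw [hassoc] at hP hPn
  have hinv := hP.of_comp hz hPn hda
  have hgcd : (U₂.natDegree * a).gcd b = U₂.natDegree := by
    rw [Nat.Coprime.gcd_mul_right_cancel _ hab, hdeg, Nat.gcd_mul_left_right]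
  obtain ⟨E, hE, hEd⟩ := exists_isTwistInvariant_gcd (FractionRing ℂ[X]) hz hinv hda hB hb
  rw [hgcd] at hE hEd
  obtain ⟨K, hK⟩ := hE.exists_comp hz hEd (hB.mono ⟨U₁.natDegree, by rw [hdeg, mul_comm]⟩)
  rcases hBp K E hK with h | h
  · left
    have hd : b = K.natDegree * E.natDegree := by rw [← hb, hK, natDegree_comp]
    rw [h, one_mul, hEd, hdeg] at hd
    exact Nat.eq_of_mul_eq_mul_right (Nat.pos_of_ne_zero h2) (by rw [hd, one_mul])
  · right
    rw [← hEd, h]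

/-- Two prime right factors of a polynomial are linearly equivalent, or they are completed to
a common left multiple by prime polynomials. -/
theorem exists_of_comp_eq_comp {U A V B : ℂ[X]} (h : U.comp A = V.comp B)
    (hA : IsPrimePoly A) (hA2 : 2 ≤ A.natDegree) (hB : IsPrimePoly B) (hB2 : 2 ≤ B.natDegree)
    (hU : U.natDegree ≠ 0) :
    (∃ l : ℂ[X], l.natDegree = 1 ∧ B = l.comp A) ∨
    ∃ W U' V' : ℂ[X], IsPrimePoly U' ∧ 2 ≤ U'.natDegree ∧ IsPrimePoly V' ∧ 2 ≤ V'.natDegree ∧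
      U'.comp A = V'.comp B ∧ U = W.comp U' ∧ V = W.comp V' := by
  set a := A.natDegree with ha
  set b := B.natDegree with hb
  have hn0 : (U.comp A).natDegree ≠ 0 := by
    rw [natDegree_comp]
    exact mul_ne_zero hU (by omega)
  obtain ⟨z, hz, hzP⟩ := exists_isMonicPole (U.comp A) (Nat.one_le_iff_ne_zero.mpr hn0)
  have hP := isTwistInvariant_of_aeval_eq_single hzP
  generalize hn : (U.comp A).natDegree = n at *
  have : NeZero n := ⟨hn0⟩
  have : NeZero a := ⟨by omega⟩
  have : NeZero b := ⟨by omega⟩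
  have hAi : IsTwistInvariant z a A := hP.of_comp hz hn ha.symm
  have hP' := hP
  have hn' := hn
  rw [h] at hP' hn'
  have hBi : IsTwistInvariant z b B := hP'.of_comp hz hn' hb.symm
  have han : a ∣ n := ⟨U.natDegree, by rw [← hn, natDegree_comp, mul_comm]⟩
  have hbn : b ∣ n := ⟨V.natDegree, by rw [← hn', natDegree_comp, mul_comm]⟩
  by_cases hab : a = b
  · left
    obtain ⟨l, hl⟩ := hAi.exists_comp hz ha.symm (hab ▸ hBi)
    refine ⟨l, ?_, hl⟩
    have h1 : b = l.natDegree * a := by rw [hb, hl, natDegree_comp]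
    rw [hab] at h1
    exact Nat.eq_of_mul_eq_mul_right (by omega) (h1.symm.trans (one_mul b).symm)
  right
  -- `A` and `B` both factor through `E` of degree `gcd a b`. If `E` were not linear, primality
  -- would make both left factors linear and the degrees equal.
  have hcop : a.Coprime b := by
    obtain ⟨E, hE, hEd⟩ := exists_isTwistInvariant_gcd (FractionRing ℂ[X]) hz hAi ha.symm hBi
      hb.symm
    have : NeZero (a.gcd b) := ⟨Nat.gcd_ne_zero_left (NeZero.ne a)⟩
    obtain ⟨K, hK⟩ := hE.exists_comp hz hEd (hAi.mono (Nat.gcd_dvd_left a b))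
    obtain ⟨L, hL⟩ := hE.exists_comp hz hEd (hBi.mono (Nat.gcd_dvd_right a b))
    rcases hA K E hK with hK1 | hE1
    · rcases hB L E hL with hL1 | hE1
      · exfalso
        apply hab
        rw [ha, hb, hK, hL, natDegree_comp, natDegree_comp, hK1, hL1]
      · rw [hEd] at hE1
        exact hE1
    · rw [hEd] at hE1
      exact hE1
  obtain ⟨D, hDa, hDb, hDd⟩ := exists_isTwistInvariant_mul hz hAi ha.symm hBi hb.symm
  have hDab := hDa.mul_of_coprime hcop hDb
  obtain ⟨U', hU'⟩ := hAi.exists_comp hz ha.symm hDa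
  obtain ⟨V', hV'⟩ := hBi.exists_comp hz hb.symm hDb
  have : NeZero (a * b) := ⟨mul_ne_zero (NeZero.ne a) (NeZero.ne b)⟩
  -- As `ab` divides `n`, the whole polynomial is invariant under the `ab`-th roots of unity and so
  -- factors through `D`.
  obtain ⟨W, hW⟩ := hDab.exists_comp hz hDd (hP.mono (hcop.mul_dvd_of_dvd_of_dvd han hbn))
  have hUd : U'.natDegree = b := by
    rw [hU', natDegree_comp, ← ha, mul_comm] at hDd
    exact Nat.eq_of_mul_eq_mul_left (Nat.pos_of_ne_zero (NeZero.ne a)) hDd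
  have hVd : V'.natDegree = a := by
    rw [hV', natDegree_comp, ← hb] at hDd
    exact Nat.eq_of_mul_eq_mul_right (Nat.pos_of_ne_zero (NeZero.ne b)) hDd
  have hUW : U = W.comp U' := by
    apply comp_right_cancel (A := A) (by omega)
    rw [hW, hU', comp_assoc]
  have hVW : V = W.comp V' := by
    apply comp_right_cancel (A := B) (by omega)
    rw [← h, hW, hV', comp_assoc]
  refine ⟨W, U', V', ?_, by omega, ?_, by omega, by rw [← hU', ← hV'], hUW, hVW⟩
  · rw [hUW] at hP hn
    exact isPrimePoly_of_twistInvariant hz hP hn ha.symm hBi hb.symm hB hcop hUd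
  · rw [hVW] at hP' hn'
    exact isPrimePoly_of_twistInvariant hz hP' hn' hb.symm hAi ha.symm hA hcop.symm hVd

/-! ### Prime decompositions and Ritt's first theorem -/

lemma isPrimePoly_of_natDegree_eq_one {P : ℂ[X]} (hP : P.natDegree = 1) : IsPrimePoly P := by
  intro Q R h
  rw [h, natDegree_comp] at hP
  exact Or.inl (Nat.eq_one_of_mul_eq_one_right hP)

lemma exists_comp_inverse {l : ℂ[X]} (hl : l.natDegree = 1) :
    ∃ m : ℂ[X], m.natDegree = 1 ∧ l.comp m = X ∧ m.comp l = X := by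
  obtain ⟨a, ha, b, rfl⟩ := natDegree_eq_one.mp hl
  refine ⟨C a⁻¹ * X + C (-(a⁻¹ * b)), natDegree_linear (inv_ne_zero ha), ?_, ?_⟩
  · simp only [add_comp, mul_comp, C_comp, X_comp]
    rw [mul_add, ← mul_assoc, ← C_mul, ← C_mul, mul_inv_cancel₀ ha, mul_neg, mul_inv_cancel_left₀ ha]
    simp
  · simp only [add_comp, mul_comp, C_comp, X_comp]
    rw [mul_add, ← mul_assoc, ← C_mul, ← C_mul, inv_mul_cancel₀ ha]
    simp

lemma IsPrimePoly.comp_linear {P l : ℂ[X]} (hP : IsPrimePoly P) (hl : l.natDegree = 1) :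
    IsPrimePoly (P.comp l) := by
  obtain ⟨m, hm, hlm, -⟩ := exists_comp_inverse hl
  intro Q R h
  have h1 : P = Q.comp (R.comp m) := by
    rw [← comp_assoc, ← h, comp_assoc, hlm, comp_X]
  simpa [natDegree_comp, hm] using hP _ _ h1

lemma IsPrimePoly.linear_comp {P l : ℂ[X]} (hP : IsPrimePoly P) (hl : l.natDegree = 1) :
    IsPrimePoly (l.comp P) := by
  obtain ⟨m, hm, -, hml⟩ := exists_comp_inverse hl
  intro Q R h
  have h1 : P = (m.comp Q).comp R := by
    rw [comp_assoc, ← h, ← comp_assoc, hml, X_comp]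
  simpa [natDegree_comp, hm] using hP _ _ h1

@[simp] lemma compList_nil : compList [] = X := rfl

@[simp] lemma compList_cons (P : ℂ[X]) (L : List ℂ[X]) :
    compList (P :: L) = P.comp (compList L) := rfl

lemma compList_append (L M : List ℂ[X]) :
    compList (L ++ M) = (compList L).comp (compList M) := by
  induction L with
  | nil => simp
  | cons P L ih => rw [List.cons_append, compList_cons, ih, compList_cons, comp_assoc]

lemma compList_singleton (P : ℂ[X]) : compList [P] = P := by simp

lemma compList_concat (L : List ℂ[X]) (P : ℂ[X]) :
    compList (L ++ [P]) = (compList L).comp P := by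
  rw [compList_append, compList_singleton]

lemma two_le_natDegree_compList {L : List ℂ[X]} (h0 : L ≠ [])
    (hL : ∀ Q ∈ L, 2 ≤ Q.natDegree) : 2 ≤ (compList L).natDegree := by
  induction L with
  | nil => exact absurd rfl h0
  | cons P L ih =>
    have hP := hL P List.mem_cons_self
    rw [compList_cons, natDegree_comp]
    by_cases hL0 : L = []
    · simpa [hL0] using hP
    · have := ih hL0 fun Q hQ => hL Q (List.mem_cons_of_mem _ hQ)
      nlinarith

lemma IsPrimeDecomposition.two_le_natDegree {P : ℂ[X]} {L : List ℂ[X]}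
    (h : IsPrimeDecomposition P L) : 2 ≤ P.natDegree :=
  h.2.2 ▸ two_le_natDegree_compList h.1 fun Q hQ => (h.2.1 Q hQ).2

lemma IsPrimeDecomposition.append {P Q : ℂ[X]} {L M : List ℂ[X]}
    (hP : IsPrimeDecomposition P L) (hQ : IsPrimeDecomposition Q M) :
    IsPrimeDecomposition (P.comp Q) (L ++ M) :=
  ⟨by simp [hP.1], fun R hR => (List.mem_append.mp hR).elim (hP.2.1 R) (hQ.2.1 R),
    by rw [compList_append, hP.2.2, hQ.2.2]⟩

lemma IsPrimePoly.isPrimeDecomposition {P : ℂ[X]} (hP : IsPrimePoly P) (h2 : 2 ≤ P.natDegree) :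
    IsPrimeDecomposition P [P] :=
  ⟨by simp, fun Q hQ => by rw [List.mem_singleton.mp hQ]; exact ⟨hP, h2⟩, compList_singleton P⟩

theorem exists_isPrimeDecomposition (P : ℂ[X]) (hP : 2 ≤ P.natDegree) :
    ∃ L : List ℂ[X], IsPrimeDecomposition P L := by
  induction hn : P.natDegree using Nat.strong_induction_on generalizing P with
  | _ n ih =>
    by_cases hp : IsPrimePoly P
    · exact ⟨[P], hp.isPrimeDecomposition hP⟩
    · simp only [IsPrimePoly, not_forall, not_or] at hp
      obtain ⟨Q, R, h, hQ, hR⟩ := hp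
      have hd : n = Q.natDegree * R.natDegree := by rw [← hn, h, natDegree_comp]
      have hQ0 : Q.natDegree ≠ 0 := by
        intro h0
        rw [h0] at hd
        omega
      have hR0 : R.natDegree ≠ 0 := by
        intro h0
        rw [h0] at hd
        omega
      have hQ2 : 2 ≤ Q.natDegree := by omega
      have hR2 : 2 ≤ R.natDegree := by omega
      obtain ⟨L, hL⟩ := ih Q.natDegree (by rw [hd]; nlinarith) Q hQ2 rfl
      obtain ⟨M, hM⟩ := ih R.natDegree (by rw [hd]; nlinarith) R hR2 rfl
      exact ⟨L ++ M, h ▸ hL.append hM⟩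

lemma IsPrimeDecomposition.eq_singleton {P : ℂ[X]} {L : List ℂ[X]} (hP : IsPrimePoly P)
    (hL : IsPrimeDecomposition P L) : L = [P] := by
  obtain ⟨h0, h1, h2⟩ := hL
  cases L with
  | nil => exact absurd rfl h0
  | cons A L =>
    by_cases hL0 : L = []
    · subst hL0
      rw [← h2, compList_singleton]
    · have hA := (h1 A List.mem_cons_self).2
      have hc := two_le_natDegree_compList hL0 fun Q hQ => (h1 Q (List.mem_cons_of_mem _ hQ)).2
      rcases hP A (compList L) h2.symm with h | h <;> omega

/-- The list `K` is a shared prefix; a linear `W` has no prime decomposition and is absorbed as `l`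
into the last factor. -/
lemma exists_isPrimeDecomposition_comp {W U V : ℂ[X]} (hW : W.natDegree ≠ 0)
    (hU : IsPrimePoly U) (hU2 : 2 ≤ U.natDegree) (hV : IsPrimePoly V) (hV2 : 2 ≤ V.natDegree) :
    ∃ (K : List ℂ[X]) (l : ℂ[X]), l.natDegree = 1 ∧
      IsPrimeDecomposition (W.comp U) (K ++ [l.comp U]) ∧
      IsPrimeDecomposition (W.comp V) (K ++ [l.comp V]) := by
  by_cases h1 : W.natDegree = 1
  · exact ⟨[], W, h1,
      (hU.linear_comp h1).isPrimeDecomposition (by rwa [natDegree_comp, h1, one_mul]),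
      (hV.linear_comp h1).isPrimeDecomposition (by rwa [natDegree_comp, h1, one_mul])⟩
  · obtain ⟨K, hK⟩ := exists_isPrimeDecomposition W (by omega)
    refine ⟨K, X, natDegree_X, ?_, ?_⟩
    · rw [X_comp]
      exact hK.append (hU.isPrimeDecomposition hU2)
    · rw [X_comp]
      exact hK.append (hV.isPrimeDecomposition hV2)

lemma IsPrimeDecomposition.of_concat {P A : ℂ[X]} {L : List ℂ[X]} (h0 : L ≠ [])
    (h : IsPrimeDecomposition P (L ++ [A])) : IsPrimeDecomposition (compList L) L :=
  ⟨h0, fun Q hQ => h.2.1 Q (List.mem_append_left _ hQ), rfl⟩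

lemma IsPrimeDecomposition.comp_linear {P Q l : ℂ[X]} {L : List ℂ[X]}
    (h : IsPrimeDecomposition P (L ++ [Q])) (hl : l.natDegree = 1) :
    IsPrimeDecomposition (P.comp l) (L ++ [Q.comp l]) := by
  refine ⟨by simp, fun R hR => ?_, ?_⟩
  · rcases List.mem_append.mp hR with hR | hR
    · exact h.2.1 R (List.mem_append_left _ hR)
    · rw [List.mem_singleton.mp hR, natDegree_comp, hl, mul_one]
      obtain ⟨h1, h2⟩ := h.2.1 Q (List.mem_append_right _ List.mem_cons_self)
      exact ⟨h1.comp_linear hl, h2⟩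
  · rw [← h.2.2, compList_concat, compList_concat, comp_assoc]

lemma IsPrimeDecomposition.linear_comp {P Q l : ℂ[X]} {L : List ℂ[X]}
    (h : IsPrimeDecomposition P (Q :: L)) (hl : l.natDegree = 1) :
    IsPrimeDecomposition (l.comp P) (l.comp Q :: L) := by
  refine ⟨by simp, fun R hR => ?_, ?_⟩
  · rcases List.mem_cons.mp hR with hR | hR
    · rw [hR, natDegree_comp, hl, one_mul]
      obtain ⟨h1, h2⟩ := h.2.1 Q List.mem_cons_self
      exact ⟨h1.linear_comp hl, h2⟩
    · exact h.2.1 R (List.mem_cons_of_mem _ hR)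
  · rw [← h.2.2, compList_cons, compList_cons, comp_assoc]

/-- Ritt's first theorem: a function of prime polynomials that respects the relations between
compositions of two primes has the same product over all prime decompositions of a polynomial. -/
theorem prod_map_eq_of_isPrimeDecomposition {f : ℂ[X] → ℂ}
    (hf : ∀ P₁ P₂ P₃ P₄ : ℂ[X], IsPrimePoly P₁ → IsPrimePoly P₂ → IsPrimePoly P₃ →
      IsPrimePoly P₄ → 2 ≤ P₁.natDegree → 2 ≤ P₂.natDegree → 2 ≤ P₃.natDegree →
      2 ≤ P₄.natDegree → P₁.comp P₂ = P₃.comp P₄ → f P₁ * f P₂ = f P₃ * f P₄)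
    {P : ℂ[X]} {L M : List ℂ[X]} (hL : IsPrimeDecomposition P L)
    (hM : IsPrimeDecomposition P M) : (L.map f).prod = (M.map f).prod := by
  induction hn : P.natDegree using Nat.strong_induction_on generalizing P L M with
  | _ n ih =>
    obtain rfl | ⟨L', A, rfl⟩ := List.eq_nil_or_concat' L
    · exact absurd rfl hL.1
    obtain rfl | ⟨M', B, rfl⟩ := List.eq_nil_or_concat' M
    · exact absurd rfl hM.1
    obtain ⟨hA, hA2⟩ := hL.2.1 A (by simp)
    obtain ⟨hB, hB2⟩ := hM.2.1 B (by simp)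
    by_cases hL0 : L' = []
    · subst hL0
      have hPA : P = A := by rw [← hL.2.2]; simp
      rw [hM.eq_singleton (hPA ▸ hA), hPA]
      rfl
    by_cases hM0 : M' = []
    · subst hM0
      have hPB : P = B := by rw [← hM.2.2]; simp
      rw [hL.eq_singleton (hPB ▸ hB), hPB]
      rfl
    have hU := hL.of_concat hL0
    have hV := hM.of_concat hM0
    set U := compList L' with hUdef
    set V := compList M' with hVdef
    have hUA : P = U.comp A := by rw [← hL.2.2, compList_concat]
    have hVB : P = V.comp B := by rw [← hM.2.2, compList_concat]
    have hUn : U.natDegree < n := by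
      rw [← hn, hUA, natDegree_comp]
      nlinarith [hU.two_le_natDegree]
    have hVn : V.natDegree < n := by
      rw [← hn, hVB, natDegree_comp]
      nlinarith [hV.two_le_natDegree]
    have hU2 := hU.two_le_natDegree
    rw [List.map_append, List.map_append, List.prod_append, List.prod_append]
    simp only [List.map_cons, List.map_nil, List.prod_singleton]
    rcases exists_of_comp_eq_comp (hUA.symm.trans hVB) hA hA2 hB hB2 (by omega) with
      ⟨l, hl, hBl⟩ | ⟨W, U', V', hU', hU'2, hV', hV'2, hUV, hUW, hVW⟩
    · obtain rfl | ⟨N, Q, rfl⟩ := List.eq_nil_or_concat' M'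
      · exact absurd rfl hM0
      have hUV : U = V.comp l := by
        apply comp_right_cancel (A := A) (by omega)
        rw [← hUA, hVB, hBl, comp_assoc]
      obtain ⟨hQ, hQ2⟩ := hV.2.1 Q (by simp)
      -- Here `U = V ∘ l`, so `l` moves into the last factor `Q` of `V`; one relation `(Q ∘ l) ∘ A =
      -- Q ∘ B` then finishes.
      have h1 := ih _ hUn hU (hUV ▸ hV.comp_linear hl) rfl
      have h2 := hf (Q.comp l) A Q B (hQ.comp_linear hl) hA hQ hB
        (by rwa [natDegree_comp, hl, mul_one]) hA2 hQ2 hB2 (by rw [hBl, comp_assoc])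
      rw [h1]
      simp only [List.map_append, List.prod_append, List.map_cons, List.map_nil,
        List.prod_singleton]
      rw [mul_assoc, h2, mul_assoc]
    · have hW0 : W.natDegree ≠ 0 := by
        intro h0
        rw [hUW, natDegree_comp, h0, zero_mul] at hU2
        omega
      -- Both decompositions are compared with ones that share `K` and differ only in their last two
      -- primes, where `hf` applies.
      obtain ⟨K, l, hl, hKU, hKV⟩ := exists_isPrimeDecomposition_comp hW0 hU' hU'2 hV' hV'2
      have h1 := ih _ hUn hU (hUW ▸ hKU) rfl
      have h2 := ih _ hVn hV (hVW ▸ hKV) rfl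
      have h3 := hf (l.comp U') A (l.comp V') B (hU'.linear_comp hl) hA (hV'.linear_comp hl) hB
        (by rwa [natDegree_comp, hl, one_mul]) hA2 (by rwa [natDegree_comp, hl, one_mul]) hB2
        (by rw [comp_assoc, hUV, comp_assoc])
      rw [h1, h2]
      simp only [List.map_append, List.prod_append, List.map_cons, List.map_nil,
        List.prod_singleton]
      rw [mul_assoc, h3, mul_assoc]

/-- The constant function `2` respects all relations, and its product is `2 ^ length`. -/
theorem IsPrimeDecomposition.length_eq {P : ℂ[X]} {L M : List ℂ[X]}
    (hL : IsPrimeDecomposition P L) (hM : IsPrimeDecomposition P M) : L.length = M.length := by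
  have h := prod_map_eq_of_isPrimeDecomposition (f := fun _ => 2)
    (fun _ _ _ _ _ _ _ _ _ _ _ _ _ => rfl) hL hM
  simp only [List.map_const', List.prod_replicate] at h
  exact Nat.pow_right_injective le_rfl (by exact_mod_cast h)

theorem IsPrimeDecomposition.length_eq_primeLength {P : ℂ[X]} {L : List ℂ[X]}
    (hL : IsPrimeDecomposition P L) : L.length = primeLength P := by
  obtain ⟨M, hM, h⟩ := Nat.sInf_mem
    (s := {n : ℕ | ∃ L : List ℂ[X], IsPrimeDecomposition P L ∧ L.length = n}) ⟨_, L, hL, rfl⟩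
  rw [primeLength, ← h, hL.length_eq hM]

/-! ### From functions on primes to characters -/

/-- Functions of prime polynomials and constants that extend to a multiplicative character
with value `1` at the identity. -/
structure IsCharacterWeight (ψ : ℂ[X] → ℂ) : Prop where
  map_C : ∀ c : ℂ, ψ (C c) = 0
  map_linear_comp : ∀ l P : ℂ[X], l.natDegree = 1 → IsPrimePoly P → ψ (l.comp P) = ψ l * ψ P
  map_comp_linear : ∀ l P : ℂ[X], l.natDegree = 1 → IsPrimePoly P → ψ (P.comp l) = ψ P * ψ l
  map_comp_eq : ∀ P₁ P₂ P₃ P₄ : ℂ[X], IsPrimePoly P₁ → IsPrimePoly P₂ → IsPrimePoly P₃ →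
    IsPrimePoly P₄ → 2 ≤ P₁.natDegree → 2 ≤ P₂.natDegree → 2 ≤ P₃.natDegree →
    2 ≤ P₄.natDegree → P₁.comp P₂ = P₃.comp P₄ → ψ P₁ * ψ P₂ = ψ P₃ * ψ P₄

theorem IsCharacterWeight.exists_character {ψ : ℂ[X] → ℂ} (hψ : IsCharacterWeight ψ) :
    ∃ Φ : ℂ[X] → ℂ, IsMultiplicativeCharacter Φ ∧ ExtendsOnPrimes Φ ψ ∧ IsGeneratedBy Φ ψ := by
  classical
  set Φ : ℂ[X] → ℂ := fun P => if h : 2 ≤ P.natDegree then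
    ((exists_isPrimeDecomposition P h).choose.map ψ).prod else ψ P with hΦ
  have hdec : ∀ (P : ℂ[X]) (L : List ℂ[X]), IsPrimeDecomposition P L →
      Φ P = (L.map ψ).prod := by
    intro P L hL
    have h2 := hL.two_le_natDegree
    simp only [hΦ, dif_pos h2]
    exact prod_map_eq_of_isPrimeDecomposition hψ.map_comp_eq
      (exists_isPrimeDecomposition P h2).choose_spec hL
  have hsmall : ∀ P : ℂ[X], P.natDegree < 2 → Φ P = ψ P := by
    intro P hP
    simp only [hΦ, dif_neg (not_le.mpr hP)]
  have hconst : ∀ c : ℂ, Φ (C c) = 0 := by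
    intro c
    rw [hsmall _ (by simp), hψ.map_C]
  have hprime : ∀ P : ℂ[X], IsPrimePoly P → Φ P = ψ P := by
    intro P hP
    by_cases h2 : 2 ≤ P.natDegree
    · rw [hdec P _ (hP.isPrimeDecomposition h2)]
      simp
    · exact hsmall P (not_le.mp h2)
  refine ⟨Φ, ?_, ⟨fun c => by rw [hconst, hψ.map_C], hprime⟩, hconst, hdec⟩
  intro P Q
  rcases Nat.eq_zero_or_pos P.natDegree with hP | hP
  · rw [eq_C_of_natDegree_eq_zero hP, C_comp, hconst, zero_mul]
  rcases Nat.eq_zero_or_pos Q.natDegree with hQ | hQ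
  · rw [eq_C_of_natDegree_eq_zero hQ, comp_C, hconst, hconst, mul_zero]
  by_cases hP1 : P.natDegree = 1
  · by_cases hQ1 : Q.natDegree = 1
    · have hQp := isPrimePoly_of_natDegree_eq_one hQ1
      rw [hprime _ (hQp.linear_comp hP1), hψ.map_linear_comp P Q hP1 hQp,
        hprime P (isPrimePoly_of_natDegree_eq_one hP1), hprime Q hQp]
    · obtain ⟨L, hL⟩ := exists_isPrimeDecomposition Q (by omega)
      cases L with
      | nil => exact absurd rfl hL.1
      | cons A L =>
        rw [hdec Q _ hL, hdec _ _ (hL.linear_comp hP1), hsmall P (by omega), List.map_cons,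
          List.prod_cons, List.map_cons, List.prod_cons,
          hψ.map_linear_comp P A hP1 (hL.2.1 A List.mem_cons_self).1, mul_assoc]
  · obtain ⟨L, hL⟩ := exists_isPrimeDecomposition P (by omega)
    by_cases hQ1 : Q.natDegree = 1
    · obtain rfl | ⟨L, A, rfl⟩ := List.eq_nil_or_concat' L
      · exact absurd rfl hL.1
      rw [hdec P _ hL, hdec _ _ (hL.comp_linear hQ1), hsmall Q (by omega)]
      simp only [List.map_append, List.prod_append, List.map_cons, List.map_nil,
        List.prod_singleton]
      rw [hψ.map_comp_linear Q A hQ1 (hL.2.1 A (by simp)).1, mul_assoc]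
    · obtain ⟨M, hM⟩ := exists_isPrimeDecomposition Q (by omega)
      rw [hdec P L hL, hdec Q M hM, hdec _ _ (hL.append hM), List.map_append, List.prod_append]

lemma CharacterConditions.isCharacterWeight {φ : ℂ[X] → ℂ} (hφ : CharacterConditions φ)
    (h1 : φ X = 1) : IsCharacterWeight φ where
  map_C := hφ.1
  map_linear_comp l P hl hP := by
    have := hφ.2 (l.comp P) X l P (hP.linear_comp hl)
      (isPrimePoly_of_natDegree_eq_one natDegree_X) (isPrimePoly_of_natDegree_eq_one hl) hP
      comp_X
    rwa [h1, mul_one] at this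
  map_comp_linear l P hl hP := by
    have := hφ.2 (P.comp l) X P l (hP.comp_linear hl)
      (isPrimePoly_of_natDegree_eq_one natDegree_X) hP (isPrimePoly_of_natDegree_eq_one hl)
      comp_X
    rwa [h1, mul_one] at this
  map_comp_eq P₁ P₂ P₃ P₄ h₁ h₂ h₃ h₄ _ _ _ _ h := hφ.2 P₁ P₂ P₃ P₄ h₁ h₂ h₃ h₄ h

/-- Condition (ii) survives scaling `φ` by a constant, so `φ` need not be multiplicative on linear
polynomials. Moving `l` across the composition of `Q` with another prime shows that `φ (Q ∘ l) / φ
Q` is the factor by which `l` acts on either side. -/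
lemma CharacterConditions.exists_isCharacterWeight {φ : ℂ[X] → ℂ} (hφ : CharacterConditions φ)
    {Q : ℂ[X]} (hQ : IsPrimePoly Q) (hφQ : φ Q ≠ 0) :
    ∃ ψ : ℂ[X] → ℂ, IsCharacterWeight ψ ∧ ∀ P : ℂ[X], 2 ≤ P.natDegree → ψ P = φ P := by
  classical
  set ψ : ℂ[X] → ℂ := fun P => if P.natDegree = 1 then φ (Q.comp P) / φ Q else φ P with hψ
  have hψ1 : ∀ l : ℂ[X], l.natDegree = 1 → ψ l = φ (Q.comp l) / φ Q := fun l hl => by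
    simp only [hψ, if_pos hl]
  have hψ2 : ∀ P : ℂ[X], P.natDegree ≠ 1 → ψ P = φ P := fun P hP => by
    simp only [hψ, if_neg hP]
  have hswap : ∀ l P : ℂ[X], l.natDegree = 1 → IsPrimePoly P →
      φ Q * φ (l.comp P) = φ (Q.comp l) * φ P := fun l P hl hP =>
    hφ.2 Q (l.comp P) (Q.comp l) P hQ (hP.linear_comp hl) (hQ.comp_linear hl) hP
      (by rw [comp_assoc])
  have hcomm : ∀ l : ℂ[X], l.natDegree = 1 → φ (l.comp Q) = φ (Q.comp l) := fun l hl =>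
    mul_left_cancel₀ hφQ (by rw [hswap l Q hl hQ, mul_comm])
  have hswap' : ∀ l P : ℂ[X], l.natDegree = 1 → IsPrimePoly P →
      φ (P.comp l) * φ Q = φ P * φ (Q.comp l) := fun l P hl hP => by
    rw [← hcomm l hl]
    exact hφ.2 (P.comp l) Q P (l.comp Q) (hP.comp_linear hl) hQ hP (hQ.linear_comp hl)
      (by rw [comp_assoc])
  have hlin : ∀ l m : ℂ[X], l.natDegree = 1 → m.natDegree = 1 →
      ψ (l.comp m) = ψ l * ψ m := by
    intro l m hl hm
    have h1 := hswap' m (Q.comp l) hm (hQ.comp_linear hl)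
    rw [hψ1 _ (by rw [natDegree_comp, hl, hm]), hψ1 l hl, hψ1 m hm, ← comp_assoc,
      div_mul_div_comm, ← h1, mul_div_mul_right _ _ hφQ]
  refine ⟨ψ, ⟨fun c => ?_, fun l P hl hP => ?_, fun l P hl hP => ?_, ?_⟩,
    fun P hP => hψ2 P (by omega)⟩
  · rw [hψ2 _ (by simp), hφ.1]
  · by_cases hP1 : P.natDegree = 1
    · exact hlin l P hl hP1
    · rw [hψ2 P hP1, hψ2 _ (by rwa [natDegree_comp, hl, one_mul]), hψ1 l hl,
        div_mul_eq_mul_div, ← hswap l P hl hP, mul_div_cancel_left₀ _ hφQ]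
  · by_cases hP1 : P.natDegree = 1
    · exact hlin P l hP1 hl
    · rw [hψ2 P hP1, hψ2 _ (by rwa [natDegree_comp, hl, mul_one]), hψ1 l hl,
        ← mul_div_assoc, ← hswap' l P hl hP, mul_div_cancel_right₀ _ hφQ]
  · intro P₁ P₂ P₃ P₄ h₁ h₂ h₃ h₄ d₁ d₂ d₃ d₄ h
    rw [hψ2 P₁ (by omega), hψ2 P₂ (by omega), hψ2 P₃ (by omega), hψ2 P₄ (by omega)]
    exact hφ.2 P₁ P₂ P₃ P₄ h₁ h₂ h₃ h₄ h

lemma prod_map_eq_zero {φ : ℂ[X] → ℂ} {P : ℂ[X]} {L : List ℂ[X]}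
    (hL : IsPrimeDecomposition P L)
    (h : ∀ Q : ℂ[X], IsPrimePoly Q → 2 ≤ Q.natDegree → φ Q = 0) : (L.map φ).prod = 0 := by
  obtain ⟨Q, hQ⟩ := List.exists_mem_of_ne_nil L hL.1
  exact List.prod_eq_zero
    (List.mem_map.mpr ⟨Q, hQ, h Q (hL.2.1 Q hQ).1 (hL.2.1 Q hQ).2⟩)

/-- The product formula leaves values on linear polynomials free, so they may be renormalized; if
`φ` vanishes on all primes of degree at least two, the zero character serves. -/
theorem CharacterConditions.exists_character {φ : ℂ[X] → ℂ} (hφ : CharacterConditions φ) :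
    ∃ Φ : ℂ[X] → ℂ, IsMultiplicativeCharacter Φ ∧ IsGeneratedBy Φ φ := by
  by_cases h : ∀ Q : ℂ[X], IsPrimePoly Q → 2 ≤ Q.natDegree → φ Q = 0
  · exact ⟨fun _ => 0, fun _ _ => by simp, fun _ => rfl,
      fun P L hL => (prod_map_eq_zero hL h).symm⟩
  · push Not at h
    obtain ⟨Q, hQ, -, hφQ⟩ := h
    obtain ⟨ψ, hψ, hψφ⟩ := hφ.exists_isCharacterWeight hQ hφQ
    obtain ⟨Φ, hΦ, -, hC, hgen⟩ := hψ.exists_character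
    refine ⟨Φ, hΦ, hC, fun P L hL => ?_⟩
    rw [hgen P L hL, List.map_congr_left fun Q hQ => hψφ Q (hL.2.1 Q hQ).2]

lemma IsMultiplicativeCharacter.map_compList {Φ : ℂ[X] → ℂ} (hΦ : IsMultiplicativeCharacter Φ)
    {P : ℂ[X]} {L : List ℂ[X]} (h0 : L ≠ []) (hL : compList L = P) :
    Φ P = (L.map Φ).prod := by
  induction L generalizing P with
  | nil => exact absurd rfl h0
  | cons A L ih =>
    by_cases hL0 : L = []
    · subst hL0
      rw [← hL, compList_singleton]
      simp
    · rw [← hL, compList_cons, hΦ, List.map_cons, List.prod_cons, ih hL0 rfl]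

lemma eq_of_extendsOnPrimes {Φ Ψ φ : ℂ[X] → ℂ} (hΦ : IsMultiplicativeCharacter Φ)
    (hΨ : IsMultiplicativeCharacter Ψ) (hΦφ : ExtendsOnPrimes Φ φ)
    (hΨφ : ExtendsOnPrimes Ψ φ) : Ψ = Φ := by
  funext P
  rcases Nat.eq_zero_or_pos P.natDegree with hP | hP
  · rw [eq_C_of_natDegree_eq_zero hP, hΦφ.1, hΨφ.1]
  by_cases hP1 : P.natDegree = 1
  · have hp := isPrimePoly_of_natDegree_eq_one hP1
    rw [hΦφ.2 P hp, hΨφ.2 P hp]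
  · obtain ⟨L, hL⟩ := exists_isPrimeDecomposition P (by omega)
    rw [hΦ.map_compList hL.1 hL.2.2, hΨ.map_compList hL.1 hL.2.2,
      List.map_congr_left fun Q hQ =>
        (hΨφ.2 Q (hL.2.1 Q hQ).1).trans (hΦφ.2 Q (hL.2.1 Q hQ).1).symm]

theorem CharacterConditions.exists_unique_extension {φ : ℂ[X] → ℂ} (hφ : CharacterConditions φ)
    (h : φ X = 1 ∨ ∀ P : ℂ[X], IsPrimePoly P → φ P = 0) :
    ∃ Φ : ℂ[X] → ℂ, IsMultiplicativeCharacter Φ ∧ ExtendsOnPrimes Φ φ ∧ IsGeneratedBy Φ φ ∧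
      ∀ Ψ : ℂ[X] → ℂ, IsMultiplicativeCharacter Ψ → ExtendsOnPrimes Ψ φ → Ψ = Φ := by
  obtain ⟨Φ, hΦ, hext, hgen⟩ : ∃ Φ : ℂ[X] → ℂ,
      IsMultiplicativeCharacter Φ ∧ ExtendsOnPrimes Φ φ ∧ IsGeneratedBy Φ φ := by
    rcases h with h | h
    · exact (hφ.isCharacterWeight h).exists_character
    · exact ⟨fun _ => 0, fun _ _ => by simp,
        ⟨fun c => (hφ.1 c).symm, fun P hP => (h P hP).symm⟩, fun _ => rfl,
        fun P L hL => (prod_map_eq_zero hL fun Q hQ _ => h Q hQ).symm⟩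
  exact ⟨Φ, hΦ, hext, hgen, fun Ψ hΨ hΨφ => eq_of_extendsOnPrimes hΦ hΨ hext hΨφ⟩

theorem IsMultiplicativeCharacter.characterConditions {Φ : ℂ[X] → ℂ}
    (hΦ : IsMultiplicativeCharacter Φ) (h1 : Φ ≠ fun _ => 1) :
    CharacterConditions Φ ∧ (Φ X = 1 ∨ ∀ P : ℂ[X], Φ P = 0) ∧ IsGeneratedBy Φ Φ := by
  have hC : ∀ c : ℂ, Φ (C c) = 0 := by
    intro c
    by_contra hc
    apply h1
    funext Q
    -- Since `c ∘ Q = c`, a nonzero `Φ(c)` forces `Φ(Q) = 1` for every `Q`.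
    have h := hΦ (C c) Q
    rw [C_comp] at h
    exact (mul_eq_left₀ hc).mp h.symm
  refine ⟨⟨hC, fun P₁ P₂ P₃ P₄ _ _ _ _ h => by rw [← hΦ, ← hΦ, h]⟩, ?_, hC,
    fun P L hL => hΦ.map_compList hL.1 hL.2.2⟩
  by_cases hX : Φ X = 1
  · exact Or.inl hX
  · right
    intro P
    by_contra hP
    have h := hΦ P X
    rw [comp_X] at h
    exact hX ((mul_eq_left₀ hP).mp h.symm)

/-! ### The length character -/

lemma isMultiplicativeCharacter_lengthCharacter : IsMultiplicativeCharacter lengthCharacter := by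
  classical
  set ψ : ℂ[X] → ℂ := fun P =>
    if P.natDegree = 0 then 0 else if P.natDegree = 1 then 1 else Complex.exp 1 with hψ
  have h1 : ∀ P : ℂ[X], P.natDegree = 1 → ψ P = 1 := fun P hP => by simp [hψ, hP]
  have h2 : ∀ P : ℂ[X], 2 ≤ P.natDegree → ψ P = Complex.exp 1 := fun P hP => by
    simp only [hψ, if_neg (show P.natDegree ≠ 0 by omega), if_neg (show P.natDegree ≠ 1 by omega)]
  have hw : IsCharacterWeight ψ :=
    { map_C := fun c => by simp [hψ]
      map_linear_comp := fun l P hl _ => by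
        rw [h1 l hl, one_mul]
        simp only [hψ, natDegree_comp, hl, one_mul]
      map_comp_linear := fun l P hl _ => by
        rw [h1 l hl, mul_one]
        simp only [hψ, natDegree_comp, hl, mul_one]
      map_comp_eq := fun P₁ P₂ P₃ P₄ _ _ _ _ d₁ d₂ d₃ d₄ _ => by
        rw [h2 P₁ d₁, h2 P₂ d₂, h2 P₃ d₃, h2 P₄ d₄] }
  obtain ⟨Φ, hΦ, hext, hC, hgen⟩ := hw.exists_character
  have heq : lengthCharacter = Φ := by
    funext P
    rcases Nat.eq_zero_or_pos P.natDegree with hP | hP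
    · rw [lengthCharacter, if_pos hP, eq_C_of_natDegree_eq_zero hP, hC]
    rw [lengthCharacter, if_neg hP.ne']
    by_cases hP1 : P.natDegree = 1
    · have hlen : primeLength P = 0 := by
        rw [primeLength, Nat.sInf_eq_zero]
        right
        ext n
        simp only [Set.mem_ofPred_eq, Set.mem_empty_iff_false, iff_false, not_exists, not_and]
        intro L hL
        have := hL.two_le_natDegree
        omega
      rw [hext.2 P (isPrimePoly_of_natDegree_eq_one hP1), h1 P hP1, hlen]
      simp
    · obtain ⟨L, hL⟩ := exists_isPrimeDecomposition P (by omega)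
      rw [hgen P L hL, List.map_congr_left fun Q hQ => h2 Q (hL.2.1 Q hQ).2, List.map_const',
        List.prod_replicate, hL.length_eq_primeLength, ← Complex.exp_nat_mul, mul_one]
  rw [heq]
  exact hΦ

/-- A quadratic is symmetric about its critical point. -/
lemma exists_eval_add_eq_eval_sub {R : ℂ[X]} (hR : R.natDegree = 2) :
    ∃ r : ℂ, ∀ s : ℂ, R.eval (r + s) = R.eval (r - s) := by
  have ha : R.coeff 2 ≠ 0 := by
    rw [← hR, coeff_natDegree, Ne, leadingCoeff_eq_zero]
    rintro rfl
    simp at hR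
  refine ⟨-(R.coeff 1 / (2 * R.coeff 2)), fun s => ?_⟩
  rw [eval_eq_sum_range, eval_eq_sum_range, hR]
  simp only [Finset.sum_range_succ, Finset.sum_range_zero]
  field_simp
  ring

/-- A nontrivial right factor would be quadratic, making `X ^ 4 + X` symmetric about some `r`.
Comparing the shifts `s = 1` and `s = 2` gives `r = 0`, but the polynomial is not even. -/
lemma isPrimePoly_X_pow_four_add_X : IsPrimePoly (X ^ 4 + X) := by
  intro Q R h
  have hdeg : (X ^ 4 + X : ℂ[X]).natDegree = 4 := by compute_degree!
  rw [h, natDegree_comp] at hdeg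
  by_contra hne
  push Not at hne
  have hR : R.natDegree = 2 := by
    have h4 : R.natDegree ∣ 4 := ⟨Q.natDegree, by rw [mul_comm]; exact hdeg.symm⟩
    have hle := Nat.le_of_dvd (by norm_num) h4
    have hQ1 := hne.1
    have hR1 := hne.2
    interval_cases hr : R.natDegree <;> omega
  obtain ⟨r, hr⟩ := exists_eval_add_eq_eval_sub hR
  have hs : ∀ s : ℂ, (r + s) ^ 4 + (r + s) = (r - s) ^ 4 + (r - s) := by
    intro s
    have he : ∀ x : ℂ, x ^ 4 + x = Q.eval (R.eval x) := fun x => by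
      rw [← eval_comp, ← h]
      simp
    rw [he, he, hr]
  have h1 := hs 1
  have h2 := hs 2
  have hr0 : r = 0 := by linear_combination (1 / 48) * h2 - (1 / 24) * h1
  rw [hr0] at h1
  norm_num at h1

lemma isPrimePoly_of_prime_natDegree {P : ℂ[X]} (hP : P.natDegree.Prime) : IsPrimePoly P := by
  intro Q R h
  rw [h, natDegree_comp, Nat.prime_mul_iff] at hP
  tauto

lemma lengthCharacter_eq {P : ℂ[X]} {L : List ℂ[X]} (hL : IsPrimeDecomposition P L) :
    lengthCharacter P = Complex.exp (L.length : ℂ) := by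
  have := hL.two_le_natDegree
  rw [lengthCharacter, if_neg (by omega), hL.length_eq_primeLength]

/-- In degree four, `X ^ 4 + X` has length one and `X ^ 2 ∘ X ^ 2` has length two. -/
lemma lengthCharacter_not_function_of_natDegree :
    ¬ ∃ g : ℕ → ℂ, ∀ P : ℂ[X], P.natDegree ≠ 0 → lengthCharacter P = g P.natDegree := by
  rintro ⟨g, hg⟩
  have hd1 : (X ^ 4 + X : ℂ[X]).natDegree = 4 := by compute_degree!
  have hd2 : (X ^ 2 : ℂ[X]).natDegree = 2 := natDegree_X_pow 2
  have hX2 : IsPrimePoly (X ^ 2) := isPrimePoly_of_prime_natDegree (by rw [hd2]; norm_num)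
  have hdec1 := isPrimePoly_X_pow_four_add_X.isPrimeDecomposition (by rw [hd1]; norm_num)
  have hdec2 := (hX2.isPrimeDecomposition hd2.ge).append (hX2.isPrimeDecomposition hd2.ge)
  have hd3 : ((X ^ 2 : ℂ[X]).comp (X ^ 2)).natDegree = 4 := by rw [natDegree_comp, hd2]
  have h1 := hg _ (by rw [hd1]; norm_num)
  have h2 := hg _ (by rw [hd3]; norm_num)
  rw [lengthCharacter_eq hdec1, hd1] at h1
  rw [lengthCharacter_eq hdec2, hd3, ← h1] at h2
  have h3 := congrArg (fun w => ‖w‖) h2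
  simp only [Complex.norm_exp] at h3
  have h4 := Real.exp_injective h3
  norm_num at h4

theorem mainTheorem1 :
    -- a function satisfying the conditions generates a character, by products over
    -- prime decompositions
    (∀ φ : ℂ[X] → ℂ, CharacterConditions φ →
      ∃ Φ : ℂ[X] → ℂ, IsMultiplicativeCharacter Φ ∧ IsGeneratedBy Φ φ) ∧
    -- if moreover it takes the value `1` at the identity `z` (or vanishes on all primes), it
    -- extends to exactly one character, which is given by products over prime decompositions
    (∀ φ : ℂ[X] → ℂ, CharacterConditions φ →
      (φ X = 1 ∨ ∀ P : ℂ[X], IsPrimePoly P → φ P = 0) →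
      ∃ Φ : ℂ[X] → ℂ, IsMultiplicativeCharacter Φ ∧ ExtendsOnPrimes Φ φ ∧ IsGeneratedBy Φ φ ∧
        ∀ Ψ : ℂ[X] → ℂ, IsMultiplicativeCharacter Ψ → ExtendsOnPrimes Ψ φ → Ψ = Φ) ∧
    -- conversely, every character but the constant `1` satisfies the conditions
    (∀ Φ : ℂ[X] → ℂ, IsMultiplicativeCharacter Φ → Φ ≠ (fun _ => 1) →
      CharacterConditions Φ ∧ (Φ X = 1 ∨ ∀ P : ℂ[X], Φ P = 0) ∧ IsGeneratedBy Φ Φ) ∧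
    -- prime decompositions exist and have a well-defined length
    (∀ P : ℂ[X], 2 ≤ P.natDegree → ∃ L : List ℂ[X], IsPrimeDecomposition P L) ∧
    (∀ (P : ℂ[X]) (L : List ℂ[X]), IsPrimeDecomposition P L → L.length = primeLength P) ∧
    -- `e ^ length` is a character, and it is not a function of the degree, even on
    -- nonconstant polynomials
    IsMultiplicativeCharacter lengthCharacter ∧
    (¬ ∃ g : ℕ → ℂ, ∀ P : ℂ[X], P.natDegree ≠ 0 → lengthCharacter P = g P.natDegree) := by
  exact ⟨fun φ hφ => hφ.exists_character, fun φ hφ h => hφ.exists_unique_extension h,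
    fun Φ hΦ h => hΦ.characterConditions h, exists_isPrimeDecomposition,
    fun P L hL => hL.length_eq_primeLength, isMultiplicativeCharacter_lengthCharacter,
    lengthCharacter_not_function_of_natDegree⟩
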